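/- Let $d\ge 1$ and let $\Delta=\mathrm{conv}(v_1,\dots,v_{2d})\subset\mathbb{R}^{2d-1}$ be a $(2d-1)$-dimensional lattice simplex (i.e. $v_1,\dots,v_{2d}\in\mathbb{Z}^{2d-1}$ are affinely independent) all of whose codimension $1$ facets are basic. Here a $k$-dimensional lattice simplex with vertices $w_1,\dots,w_{k+1}\in\mathbb{Z}^n$ is called basic if $w_1-w_{k+1},\dots,w_k-w_{k+1}$ is part of a lattice basis of $\mathbb{Z}^n$. Then the following statements are equivalent: 1. For all $k=1,\dots,d-1$ there are no lattice points in the interior of $k\Delta$, i.e. $\mathrm{Int}(k\Delta)\cap\mathbb{Z}^{2d-1}=\emptyset$. 2. There are $1$-dimensional lattice simplices (non-degenerate lattice segments) $\Delta_1,\dots,\Delta_d\subset\mathbb{R}^d$ such that $\Delta\cong\Delta_1*\dots*\Delta_d$. Here $\Delta_1*\dots*\Delta_d\subset\mathbb{R}^{d}\times\mathbb{R}^{d}=\mathbb{R}^{2d}$ is the Cayley polytope, the convex hull of $\bigcup_{i=1}^d \{e_i\}\times\Delta_i$ with $e_1,\dots,e_d$ the standard basis of $\mathbb{R}^d$. For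 polytopes $P\subset\mathbb{R}^m$ and $Q\subset\mathbb{R}^n$, $P\cong Q$ means affine unimodular isomorphism: there is an affine map that restricts to a bijection from the affine span of $P$ onto the affine span of $Q$, maps the lattice points $\mathrm{aff}(P)\cap\mathbb{Z}^m$ bijectively onto $\mathrm{aff}(Q)\cap\mathbb{Z}^n$, and maps $P$ onto $Q$. -/

import Mathlib

open scoped Pointwise

namespace GenWhite

/-- The standard lattice `ℤ^ι` inside `ℝ^ι`. -/
def latticePoints (ι : Type) : Set (ι → ℝ) :=
  Set.range fun (z : ι → ℤ) (i : ι) => (z i : ℝ)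

/-- A lattice simplex: all its vertices are lattice points. -/
def IsLatticeSimplex {n k : ℕ} (s : Affine.Simplex ℝ (Fin n → ℝ) k) : Prop :=
  ∀ i, s.points i ∈ latticePoints (Fin n)

/-- The simplex as a point set: the convex hull of its vertices. -/
def body {n k : ℕ} (s : Affine.Simplex ℝ (Fin n → ℝ) k) : Set (Fin n → ℝ) :=
  convexHull ℝ (Set.range s.points)

/-- A basic (unimodular) lattice simplex: with vertices `v₁, …, v_{k+1}`, the differences
`v₁ - v_{k+1}, …, v_k - v_{k+1}` are part of a lattice basis of `ℤⁿ`. -/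
def IsBasicSimplex {n k : ℕ} (s : Affine.Simplex ℝ (Fin n → ℝ) k) : Prop :=
  IsLatticeSimplex s ∧
    ∃ (b : Module.Basis (Fin n) ℤ (Fin n → ℤ)) (e : Fin k ↪ Fin n),
      ∀ i : Fin k, s.points i.castSucc - s.points (Fin.last k) = fun j => (b (e i) j : ℝ)

/-- Every codimension 1 face of an `n`-dimensional simplex is basic. -/
def FacetsBasic {n : ℕ} (s : Affine.Simplex ℝ (Fin n → ℝ) n) : Prop :=
  ∀ (m : ℕ) (t : Finset (Fin (n + 1))) (h : t.card = m + 1), m + 1 = n →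
    IsBasicSimplex (s.face h)

/-- The Cayley polytope `P₁ * ⋯ * P_r ⊆ ℝ^r × ℝ^d = ℝ^{r+d}`: the convex hull of the sets
`e_i × P_i`. -/
def cayley {r d : ℕ} (P : Fin r → Set (Fin d → ℝ)) : Set (Fin r ⊕ Fin d → ℝ) :=
  convexHull ℝ (⋃ i, (fun x : Fin d → ℝ => Sum.elim (Pi.single i (1 : ℝ)) x) '' P i)

/-- Affine unimodular isomorphism of (lattice) polytopes `P ⊆ ℝ^ι` and `Q ⊆ ℝ^κ`: an affine map
restricting to a bijection of the affine spans which identifies the lattice points of the affine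
spans and carries `P` onto `Q`. The ambient dimensions may differ. -/
def UnimodularIso {ι κ : Type} (P : Set (ι → ℝ)) (Q : Set (κ → ℝ)) : Prop :=
  ∃ f : (ι → ℝ) →ᵃ[ℝ] (κ → ℝ),
    Set.BijOn f (affineSpan ℝ P) (affineSpan ℝ Q) ∧
    (∀ x ∈ affineSpan ℝ P, f x ∈ latticePoints κ ↔ x ∈ latticePoints ι) ∧
    f '' P = Q

end GenWhite

/-!
For a lattice simplex `Δ` with vertices `v_i`, `i ∈ ι`, let `L ⊆ ℝ^ι` be the group of all `x` with
`∑ x_i ∈ ℤ` and `∑ x_i v_i` a lattice point (`coneLattice`); it contains `ℤ^ι`. That the facets are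
basic says that a point of `L` with one integral coordinate lies in `ℤ^ι`
(`FacetsBasic.mem_latticePoints`). Hence a single coordinate embeds `L / ℤ^ι` into `ℝ / ℤ`, so that
`L = ℤ^ι + ℤ · (a / n)` for an integral vector `a` all of whose entries are prime to `n`
(`exists_generator`).

Suppose no multiple `kΔ`, `1 ≤ k ≤ d - 1`, has an interior lattice point. Then every point of `L`
with positive coordinates has coordinate sum at least `d`. Applied to the fractional parts of `x` and
of `-x`, this forces `∑ {x_i} = d` for all `x ∈ L \ ℤ^ι` (`sum_fract_eq`), as there are `2d`
coordinates. In terms of the sawtooth function on `ZMod n`, `∑_i ((a_i g / n)) = 0` for every `g`.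

The arithmetic core is that the `a_i` then cancel in pairs modulo `n`. The discrete Fourier transform
of the sawtooth function is a multiple of `k ↦ cot (π k / n)` (`dft_sawtooth`), and for every odd
Dirichlet character `χ` modulo `n`, primitive or not, `∑_k χ(k) cot (π k / n)` is a nonzero multiple
of `L(1, χ) ≠ 0` (`DirichletCharacter.Odd.LFunction_one`). Therefore `∑_i χ(a_i) = 0` for all odd
`χ`, and orthogonality of characters shows that `u` and `-u` occur equally often among the `a_i`
(`card_eq_card_neg_of_sum_sawtooth`).

Given a pairing with `a_p + a_q ≡ 0` modulo `n`, the `d` sums `x_p + x_q` are integral on `L`, and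
they extend to an isomorphism of `L` with `ℤ^d × ℤ^d` (`pairedCoordinates`). It sends each pair of
vertices to the ends of `{e_j} × Δ_j` for a segment `Δ_j`, and composed with barycentric coordinates
it is the required unimodular isomorphism.

Conversely, a lattice point in the interior of `k (Δ_1 * ⋯ * Δ_d)` has `d` positive integral
coordinates over `e_1, …, e_d` with sum `k`, so `k ≥ d`.
-/

open Filter Topology

/-! ### The odd Hurwitz zeta function at `1` -/

theorem rpow_neg_sub_rpow_neg_le {n s : ℝ} (hn : 1 ≤ n) (hs : s ∈ Set.Icc (1 : ℝ) 2) :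
    n ^ (-s) - (n + 1) ^ (-s) ≤ 2 / n ^ 2 := by
  have hn0 : 0 < n := by linarith
  have hr : 0 < n / (n + 1) := by positivity
  have hr1 : n / (n + 1) ≤ 1 := by rw [div_le_one (by positivity)]; linarith
  have h1 : (n / (n + 1)) ^ (2 : ℝ) ≤ (n / (n + 1)) ^ s :=
    Real.rpow_le_rpow_of_exponent_ge hr hr1 hs.2
  have h2 : n ^ (-s) ≤ n⁻¹ := by
    rw [← Real.rpow_neg_one]
    exact Real.rpow_le_rpow_of_exponent_le hn (by linarith [hs.1])
  have h3 : (n + 1) ^ (-s) = n ^ (-s) * (n / (n + 1)) ^ s := by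
    rw [Real.div_rpow hn0.le (by positivity), Real.rpow_neg hn0.le, Real.rpow_neg (by positivity)]
    have : n ^ s ≠ 0 := (Real.rpow_pos_of_pos hn0 s).ne'
    field_simp
  have h4 : 1 - (n / (n + 1)) ^ 2 ≤ 2 / n := by
    rw [div_pow, one_sub_div (by positivity), div_le_div_iff₀ (by positivity) hn0]
    nlinarith
  have h1' : (n / (n + 1)) ^ (2 : ℕ) ≤ (n / (n + 1)) ^ s := by exact_mod_cast h1
  calc n ^ (-s) - (n + 1) ^ (-s) = n ^ (-s) * (1 - (n / (n + 1)) ^ s) := by rw [h3]; ring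
    _ ≤ n⁻¹ * (2 / n) := by
        apply mul_le_mul h2 ((sub_le_sub_left h1' 1).trans h4) _ (by positivity)
        have := Real.rpow_le_one hr.le hr1 (z := s) (by linarith [hs.1])
        linarith
    _ = 2 / n ^ 2 := by field_simp

/-- A summable bound, uniform in `s ∈ [1, 2]`, for the terms of the series of `hurwitzZetaOdd a s`. -/
theorem norm_rpow_neg_sub_rpow_neg_le {a s : ℝ} (ha : a ∈ Set.Ioo (0 : ℝ) 1)
    (hs : s ∈ Set.Icc (1 : ℝ) 2) (n : ℕ) :
    ‖(n + a) ^ (-s) - (n + 1 - a) ^ (-s)‖ ≤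
      if n = 0 then a ^ (-2 : ℝ) + (1 - a) ^ (-2 : ℝ) else 2 / (n : ℝ) ^ 2 := by
  obtain ⟨ha0, ha1⟩ := ha
  split_ifs with hn
  · subst hn
    have e1 : a ^ (-s) ≤ a ^ (-2 : ℝ) :=
      Real.rpow_le_rpow_of_exponent_ge ha0 ha1.le (by linarith [hs.2])
    have e2 : (1 - a) ^ (-s) ≤ (1 - a) ^ (-2 : ℝ) :=
      Real.rpow_le_rpow_of_exponent_ge (by linarith) (by linarith) (by linarith [hs.2])
    have p1 := (Real.rpow_pos_of_pos ha0 (-s)).le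
    have p2 := (Real.rpow_pos_of_pos (sub_pos.2 ha1) (-s)).le
    simp only [Nat.cast_zero, zero_add, Real.norm_eq_abs]
    rw [abs_le]
    constructor <;> linarith
  · have hn1 : (1 : ℝ) ≤ n := by exact_mod_cast Nat.one_le_iff_ne_zero.2 hn
    have key := rpow_neg_sub_rpow_neg_le hn1 hs
    have mono : ∀ x : ℝ, (n : ℝ) ≤ x → x ≤ n + 1 →
        ((n : ℝ) + 1) ^ (-s) ≤ x ^ (-s) ∧ x ^ (-s) ≤ (n : ℝ) ^ (-s) := fun x h1 h2 =>
      ⟨Real.rpow_le_rpow_of_nonpos (by linarith) h2 (by linarith [hs.1]),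
        Real.rpow_le_rpow_of_nonpos (by linarith) h1 (by linarith [hs.1])⟩
    have m1 := mono (n + a) (by linarith) (by linarith)
    have m2 := mono (n + 1 - a) (by linarith) (by linarith)
    rw [Real.norm_eq_abs, abs_le]
    constructor <;> linarith [m1.1, m1.2, m2.1, m2.2]

theorem summable_ite_two_div_sq (C : ℝ) :
    Summable fun n : ℕ => if n = 0 then C else 2 / (n : ℝ) ^ 2 := by
  rw [← summable_nat_add_iff 1]
  have := ((summable_nat_add_iff 1).2 (Real.summable_one_div_nat_pow.2 one_lt_two)).mul_left 2
  refine this.congr fun n => ?_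
  simp [div_eq_mul_inv]

/-- The Mittag-Leffler expansion of `π cot (π a)`, with the terms grouped as in the series of the odd
Hurwitz zeta function. Exponents are real powers `-1` to match the series at general `s`. -/
theorem hasSum_pi_mul_cot {a : ℝ} (ha : a ∈ Set.Ioo (0 : ℝ) 1) :
    HasSum (fun n : ℕ => (((n + a : ℝ) ^ (-1 : ℝ) - (n + 1 - a : ℝ) ^ (-1 : ℝ) : ℝ) : ℂ))
      (Real.pi * Complex.cot (Real.pi * a)) := by
  have hmem : (a : ℂ) ∈ Complex.integerComplement := by
    rintro ⟨m, hm⟩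
    have hm' : (m : ℝ) = a := by exact_mod_cast hm
    have h1 : (0 : ℝ) < m := hm' ▸ ha.1
    have h2 : (m : ℝ) < 1 := hm' ▸ ha.2
    have h1' : 0 < m := by exact_mod_cast h1
    have h2' : m < 1 := by exact_mod_cast h2
    omega
  have hsum : Summable fun n : ℕ =>
      (((n + a : ℝ) ^ (-1 : ℝ) - (n + 1 - a : ℝ) ^ (-1 : ℝ) : ℝ) : ℂ) := by
    apply Summable.of_norm_bounded (summable_ite_two_div_sq _)
    intro n
    rw [Complex.norm_real]
    exact norm_rpow_neg_sub_rpow_neg_le ha ⟨le_rfl, one_le_two⟩ n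
  rw [hsum.hasSum_iff_tendsto_nat]
  have hpart : ∀ M : ℕ, ∑ n ∈ Finset.range M,
      (((n + a : ℝ) ^ (-1 : ℝ) - (n + 1 - a : ℝ) ^ (-1 : ℝ) : ℝ) : ℂ) =
      1 / (a : ℂ) + ∑ n ∈ Finset.range M, cotTerm a n - 1 / ((a : ℂ) + M) := by
    intro M
    induction M with
    | zero => simp
    | succ M ih =>
      rw [Finset.sum_range_succ, Finset.sum_range_succ, ih, cotTerm, Real.rpow_neg_one,
        Real.rpow_neg_one]
      have : (a : ℂ) - (M + 1) = -(M + 1 - a) := by ring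
      rw [this]
      push_cast
      simp only [one_div, inv_neg, add_comm (a : ℂ)]
      ring
  simp_rw [hpart]
  have h0 : Tendsto (fun M : ℕ => 1 / ((a : ℂ) + M)) atTop (𝓝 0) := by
    have : Tendsto (fun M : ℕ => ((1 / (a + M) : ℝ) : ℂ)) atTop (𝓝 ((0 : ℝ) : ℂ)) := by
      apply (Complex.continuous_ofReal.tendsto 0).comp
      exact tendsto_const_nhds.div_atTop
        (tendsto_atTop_add_const_left _ _ tendsto_natCast_atTop_atTop)
    simpa using this
  have := ((tendsto_logDeriv_euler_cot_sub hmem).const_add (1 / (a : ℂ))).sub h0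
  simpa using this

/-- The series of `hurwitzZetaOdd a s` for `s > 1` is dominated as `s` decreases to `1`, so the value of
the analytic continuation at `1` is the (grouped) series there. -/
theorem hurwitzZetaOdd_one {a : ℝ} (ha : a ∈ Set.Ioo (0 : ℝ) 1) :
    HurwitzZeta.hurwitzZetaOdd a 1 = Real.pi * Complex.cot (Real.pi * a) / 2 := by
  have hlim : Tendsto (fun s : ℝ => HurwitzZeta.hurwitzZetaOdd a s) (𝓝[>] 1)
      (𝓝 (HurwitzZeta.hurwitzZetaOdd a 1)) := by
    have hc : Continuous fun s : ℝ => HurwitzZeta.hurwitzZetaOdd a s :=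
      (HurwitzZeta.differentiable_hurwitzZetaOdd a).continuous.comp Complex.continuous_ofReal
    simpa using (hc.tendsto 1).mono_left nhdsWithin_le_nhds
  have hIcc : ∀ᶠ s : ℝ in 𝓝[>] 1, s ∈ Set.Ioo (1 : ℝ) 2 := Ioo_mem_nhdsGT one_lt_two
  have hdom := tendsto_tsum_of_dominated_convergence (𝓕 := 𝓝[>] (1 : ℝ))
    (f := fun (s : ℝ) (n : ℕ) => (((n + a : ℝ) ^ (-s) - (n + 1 - a : ℝ) ^ (-s) : ℝ) : ℂ))
    (g := fun n : ℕ => (((n + a : ℝ) ^ (-1 : ℝ) - (n + 1 - a : ℝ) ^ (-1 : ℝ) : ℝ) : ℂ))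
    (summable_ite_two_div_sq (a ^ (-2 : ℝ) + (1 - a) ^ (-2 : ℝ)))
    (fun n => by
      apply (Complex.continuous_ofReal.tendsto _).comp
      have p1 : (n + a : ℝ) ≠ 0 := by have := ha.1; positivity
      have p2 : (n + 1 - a : ℝ) ≠ 0 := by
        have := ha.2; have : (0 : ℝ) ≤ n := n.cast_nonneg; linarith
      have : ContinuousAt (fun s : ℝ => (n + a : ℝ) ^ (-s) - (n + 1 - a : ℝ) ^ (-s)) 1 :=
        ((Real.continuousAt_const_rpow p1).comp continuousAt_neg).sub
          ((Real.continuousAt_const_rpow p2).comp continuousAt_neg)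
      exact this.tendsto.mono_left nhdsWithin_le_nhds)
    (by
      filter_upwards [hIcc] with s hs n
      rw [Complex.norm_real]
      exact norm_rpow_neg_sub_rpow_neg_le ha ⟨hs.1.le, hs.2.le⟩ n)
  rw [(hasSum_pi_mul_cot ha).tsum_eq] at hdom
  refine tendsto_nhds_unique hlim ((hdom.div_const 2).congr' ?_)
  filter_upwards [hIcc] with s hs
  have hs' : 1 < (s : ℂ).re := by simpa using hs.1
  rw [← tsum_div_const,
    ← (HurwitzZeta.hasSum_nat_hurwitzZetaOdd_of_mem_Icc ⟨ha.1.le, ha.2.le⟩ hs').tsum_eq]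
  congr with n
  have p1 : (0 : ℝ) ≤ n + a := by have := ha.1; positivity
  have p2 : (0 : ℝ) ≤ n + 1 - a := by
    have := ha.2; have : (0 : ℝ) ≤ n := n.cast_nonneg; linarith
  rw [Complex.ofReal_sub, Complex.ofReal_cpow p1, Complex.ofReal_cpow p2]
  push_cast
  rw [Complex.cpow_neg, Complex.cpow_neg, one_div, one_div]

/-! ### The sawtooth function and odd Dirichlet characters -/

open scoped ZMod

/-- The sawtooth function on `ZMod N`: the value of the periodic Bernoulli function `{t} - 1/2` at
`t = j / N`, normalised to `0` at `j = 0` so that it is odd. -/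
noncomputable def sawtooth {N : ℕ} (j : ZMod N) : ℂ :=
  if j = 0 then 0 else (j.val : ℂ) / N - 1 / 2

theorem sum_zmod_val {N : ℕ} [NeZero N] (f : ℕ → ℂ) :
    ∑ j : ZMod N, f j.val = ∑ i ∈ Finset.range N, f i := by
  obtain ⟨n, rfl⟩ := Nat.exists_eq_succ_of_ne_zero (NeZero.ne N)
  exact Fin.sum_univ_eq_sum_range f (n + 1)

theorem sub_one_mul_sum_range_mul_pow (w : ℂ) (N : ℕ) :
    (w - 1) * ∑ i ∈ Finset.range N, (i : ℂ) * w ^ i =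
      N * w ^ N - ∑ i ∈ Finset.range N, w ^ (i + 1) := by
  induction N with
  | zero => simp
  | succ N ih => rw [Finset.sum_range_succ, mul_add, ih, Finset.sum_range_succ]; push_cast; ring

/-- The Fourier transform of the sawtooth function is a multiple of the cotangent. At `k = 0` both
sides vanish, the right one because `Complex.cot 0 = 1 / 0 = 0`. -/
theorem dft_sawtooth {N : ℕ} [NeZero N] (k : ZMod N) :
    𝓕 (sawtooth : ZMod N → ℂ) k =
      Complex.I / 2 * Complex.cot (Real.pi * ((k.val / N : ℝ) : ℂ)) := by
  have hN : (N : ℂ) ≠ 0 := NeZero.ne _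
  set W : ℂ := ZMod.stdAddChar k with hW
  have hWexp : W = Complex.exp (2 * Real.pi * Complex.I * ((k.val / N : ℝ) : ℂ)) := by
    have := ZMod.stdAddChar_coe (N := N) (k.val : ℤ)
    rw [Int.cast_natCast, ZMod.natCast_zmod_val] at this
    rw [hW, this]
    congr 1
    push_cast
    ring
  have hW0 : W ≠ 0 := by rw [hWexp]; exact Complex.exp_ne_zero _
  have hchar : ∀ j : ZMod N, ZMod.stdAddChar (-(j * k)) = W⁻¹ ^ j.val := by
    intro j
    have : j * k = j.val • k := by rw [nsmul_eq_mul, ZMod.natCast_zmod_val]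
    rw [this, AddChar.map_neg_eq_inv, AddChar.map_nsmul_eq_pow, inv_pow]
  have hWN : W⁻¹ ^ N = 1 := by
    rw [inv_pow, hW, ← AddChar.map_nsmul_eq_pow]
    simp
  have hsum : 𝓕 (sawtooth : ZMod N → ℂ) k =
      (∑ i ∈ Finset.range N, W⁻¹ ^ i * ((i : ℂ) / N - 1 / 2)) + 1 / 2 := by
    have h0 : ∀ j : ZMod N, ZMod.stdAddChar (-(j * k)) • sawtooth j =
        W⁻¹ ^ j.val * ((j.val : ℂ) / N - 1 / 2) + if j = 0 then 1 / 2 else 0 := by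
      intro j
      rw [hchar, smul_eq_mul, sawtooth]
      split_ifs with hj
      · subst hj; simp
      · simp
    rw [ZMod.dft_apply, Finset.sum_congr rfl fun j _ => h0 j, Finset.sum_add_distrib,
      sum_zmod_val fun i => W⁻¹ ^ i * ((i : ℂ) / N - 1 / 2)]
    simp
  have hsplit : ∑ i ∈ Finset.range N, W⁻¹ ^ i * ((i : ℂ) / N - 1 / 2) =
      (∑ i ∈ Finset.range N, (i : ℂ) * W⁻¹ ^ i) / N - (∑ i ∈ Finset.range N, W⁻¹ ^ i) / 2 := by
    rw [Finset.sum_div, Finset.sum_div, ← Finset.sum_sub_distrib]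
    exact Finset.sum_congr rfl fun i _ => by ring
  rw [hsum, hsplit, Complex.cot_pi_eq_exp_ratio, ← hWexp]
  by_cases h1 : W = 1
  · have hg : (∑ i ∈ Finset.range N, (i : ℂ)) * 2 = N * (N - 1) := by
      have := Finset.sum_range_id_mul_two N
      have h : (((∑ i ∈ Finset.range N, i) * 2 : ℕ) : ℂ) = ((N * (N - 1) : ℕ) : ℂ) := by rw [this]
      rw [Nat.cast_mul, Nat.cast_mul, Nat.cast_sub (Nat.one_le_iff_ne_zero.2 (NeZero.ne N))] at h
      simpa using h
    have hg' : (∑ i ∈ Finset.range N, (i : ℂ)) = N * (N - 1) / 2 := by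
      rw [← hg]; ring
    simp only [h1, inv_one, one_pow, mul_one, hg', Finset.sum_const, Finset.card_range, nsmul_eq_mul,
      sub_self, mul_zero, div_zero]
    field_simp
    ring
  · have hw1 : W⁻¹ - 1 ≠ 0 := by rw [sub_ne_zero]; simpa using h1
    have hgeom : ∑ i ∈ Finset.range N, W⁻¹ ^ i = 0 := by
      have := mul_geom_sum W⁻¹ N
      rw [hWN, sub_self] at this
      exact (mul_eq_zero.1 this).resolve_left hw1
    have hi := sub_one_mul_sum_range_mul_pow W⁻¹ N
    rw [hWN] at hi
    simp only [pow_succ, ← Finset.sum_mul, hgeom] at hi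
    have hi' : ∑ i ∈ Finset.range N, (i : ℂ) * W⁻¹ ^ i = N / (W⁻¹ - 1) := by
      rw [eq_div_iff hw1]; linear_combination hi
    rw [hi', hgeom]
    have hW1 : 1 - W ≠ 0 := sub_ne_zero.2 (Ne.symm h1)
    have : W⁻¹ - 1 = (1 - W) / W := by field_simp
    rw [this]
    field_simp
    ring

/-- `L(1, χ)` as a finite cotangent sum. No primitivity is needed; the term `k = 0` is zero by the
convention `Complex.cot 0 = 0`. -/
theorem DirichletCharacter.Odd.LFunction_one {N : ℕ} [NeZero N] {χ : DirichletCharacter ℂ N}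
    (hχ : χ.Odd) : χ.LFunction 1 = (N : ℂ) ^ (-1 : ℂ) *
      (Real.pi / 2 * ∑ k : ZMod N, χ k * Complex.cot (Real.pi * ((k.val / N : ℝ) : ℂ))) := by
  rw [DirichletCharacter.LFunction, ZMod.LFunction_def_odd hχ.to_fun,
    Finset.mul_sum (a := (Real.pi / 2 : ℂ))]
  congr 1
  refine Finset.sum_congr rfl fun k _ => ?_
  have hN : (0 : ℝ) < N := by exact_mod_cast Nat.pos_of_ne_zero (NeZero.ne N)
  by_cases hk : k = 0
  · subst hk
    have : HurwitzZeta.hurwitzZetaOdd 0 1 = 0 := by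
      have := HurwitzZeta.hurwitzZetaOdd_neg 0 1
      rw [neg_zero] at this
      exact self_eq_neg.1 this
    simp [this, Complex.cot]
  · rw [ZMod.toAddCircle_apply, hurwitzZetaOdd_one]
    · ring
    · have hpos : 0 < k.val := ZMod.val_pos.2 hk
      refine ⟨by positivity, ?_⟩
      rw [div_lt_one hN]
      exact_mod_cast k.val_lt

theorem DirichletCharacter.Odd.sum_mul_cot_ne_zero {N : ℕ} [NeZero N]
    {χ : DirichletCharacter ℂ N} (hχ : χ.Odd) :
    ∑ k : ZMod N, χ k * Complex.cot (Real.pi * ((k.val / N : ℝ) : ℂ)) ≠ 0 := by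
  intro h
  have hne : χ ≠ 1 := by
    rintro rfl
    have : (1 : DirichletCharacter ℂ N) (-1) = -1 := hχ
    rw [MulChar.one_apply (isUnit_one.neg)] at this
    norm_num at this
  apply DirichletCharacter.LFunction_apply_one_ne_zero hne
  rw [hχ.LFunction_one, h]
  simp

/-- Fourier transform turns the hypothesis into the vanishing of `∑ i, cot (π a_i⁻¹ k / N)` for all `k`;
summing against `χ k` factors out the nonzero number `∑ k, χ k * cot (π k / N)`. -/
theorem DirichletCharacter.Odd.sum_eq_zero_of_sum_sawtooth {N : ℕ} [NeZero N]
    {χ : DirichletCharacter ℂ N} (hχ : χ.Odd) {ι : Type*} [Fintype ι] (a : ι → (ZMod N)ˣ)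
    (h : ∀ g : ZMod N, ∑ i, sawtooth ((a i : ZMod N) * g) = 0) :
    ∑ i, χ (a i) = 0 := by
  set C : ZMod N → ℂ := fun k => Complex.cot (Real.pi * ((k.val / N : ℝ) : ℂ))
  have hC : ∀ k : ZMod N, ∑ i, C ((a i)⁻¹.val * k) = 0 := by
    intro k
    have h1 : ∑ i, 𝓕 (fun j => sawtooth ((a i).val * j)) k = 0 := by
      rw [← Finset.sum_apply, ← map_sum]
      have : ∑ i, (fun j : ZMod N => sawtooth ((a i).val * j)) = 0 := by
        ext g
        simpa using h g
      rw [this]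
      simp
    simp_rw [ZMod.dft_comp_unitMul, dft_sawtooth, ← Finset.mul_sum] at h1
    exact (mul_eq_zero.1 h1).resolve_left (by simp)
  have h2 : (∑ i, χ (a i)) * ∑ k, χ k * C k = 0 := by
    calc (∑ i, χ (a i)) * ∑ k, χ k * C k
        = ∑ i, ∑ k, χ k * C ((a i)⁻¹.val * k) := by
          rw [Finset.sum_mul]
          refine Finset.sum_congr rfl fun i _ => ?_
          rw [Finset.mul_sum]
          refine Fintype.sum_equiv (a i).mulLeft _ _ fun k => ?_
          simp [mul_assoc]
      _ = ∑ k, χ k * ∑ i, C ((a i)⁻¹.val * k) := by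
          rw [Finset.sum_comm]
          simp_rw [Finset.mul_sum]
      _ = 0 := by simp [hC]
  exact (mul_eq_zero.1 h2).resolve_right hχ.sum_mul_cot_ne_zero

theorem card_eq_card_neg_of_sum_sawtooth {N : ℕ} [NeZero N] {ι : Type*} [Fintype ι]
    (a : ι → (ZMod N)ˣ) (h : ∀ g : ZMod N, ∑ i, sawtooth ((a i : ZMod N) * g) = 0)
    (u : (ZMod N)ˣ) :
    Fintype.card {i // a i = u} = Fintype.card {i // a i = -u} := by
  have hχ : ∀ χ : DirichletCharacter ℂ N, ∑ i, (χ (a i) - χ (-(a i))) = 0 := by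
    intro χ
    rcases χ.even_or_odd with he | ho
    · simp [he.eval_neg]
    · simp_rw [ho.eval_neg, sub_neg_eq_add, ← two_mul, ← Finset.mul_sum,
        ho.sum_eq_zero_of_sum_sawtooth a h, mul_zero]
  have h1 : ∑ i, ∑ χ : DirichletCharacter ℂ N,
      (χ (u : ZMod N)⁻¹ * χ (a i) - χ (u : ZMod N)⁻¹ * χ (-(a i))) = 0 := by
    rw [Finset.sum_comm]
    simp_rw [← mul_sub, ← Finset.mul_sum, hχ, mul_zero, Finset.sum_const_zero]
  simp_rw [Finset.sum_sub_distrib, DirichletCharacter.sum_char_inv_mul_char_eq ℂ u.isUnit] at h1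
  have hφ : (N.totient : ℂ) ≠ 0 := by
    exact_mod_cast (Nat.totient_pos.2 (Nat.pos_of_ne_zero (NeZero.ne N))).ne'
  have e1 : ∀ i, ((u : ZMod N) = a i) ↔ a i = u := fun i => by
    rw [eq_comm, Units.val_inj]
  have e2 : ∀ i, ((u : ZMod N) = -(a i)) ↔ a i = -u := fun i => by
    rw [← Units.val_neg, Units.val_inj, eq_comm, neg_eq_iff_eq_neg]
  simp_rw [e1, e2, Finset.sum_ite, Finset.sum_const_zero, add_zero, Finset.sum_const,
    nsmul_eq_mul, ← sub_mul] at h1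
  have h2 := sub_eq_zero.1 ((mul_eq_zero.1 h1).resolve_right hφ)
  rw [Fintype.card_subtype, Fintype.card_subtype]
  exact_mod_cast h2

/-! ### Pairing opposite units -/

/-- If `u` and `-u` are taken equally often by `a` on a set of even size, then the set splits into pairs
on which the values of `a` are opposite. A value equal to its own negative might be taken an odd
number of times; `hfix` excludes this by requiring it to be the only value. -/
theorem exists_pairing_of_card_eq_card_neg {ι G : Type*} [DecidableEq ι] [DecidableEq G]
    [InvolutiveNeg G] (a : ι → G) (d : ℕ) (s : Finset ι) (hs : s.card = 2 * d)
    (hc : ∀ u, (s.filter fun i => a i = u).card = (s.filter fun i => a i = -u).card)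
    (hfix : ∀ i ∈ s, ∀ j ∈ s, a i = -a i → a j = a i) :
    ∃ p q : Fin d → ι, (∀ j, a (p j) = -a (q j)) ∧ ∀ i ∈ s, ∃ j, i = p j ∨ i = q j := by
  induction d generalizing s with
  | zero =>
    have : s = ∅ := by simpa using hs
    subst this
    exact ⟨Fin.elim0, Fin.elim0, fun j => j.elim0, by simp⟩
  | succ d ih =>
    obtain ⟨i, hi⟩ : s.Nonempty := by rw [← Finset.card_pos]; omega
    by_cases hex : ∃ j ∈ s, j ≠ i ∧ a j = -a i
    · obtain ⟨j, hj, hji, haj⟩ := hex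
      have hj' : j ∈ s.erase i := Finset.mem_erase.2 ⟨hji, hj⟩
      have hcard : ∀ u, (s.filter fun l => a l = u).card =
          (((s.erase i).erase j).filter fun l => a l = u).card +
            (if a i = u then 1 else 0) + (if a j = u then 1 else 0) := by
        intro u
        simp only [Finset.card_filter]
        rw [← Finset.add_sum_erase s _ hi, ← Finset.add_sum_erase _ _ hj']
        ring
      obtain ⟨p, q, hpq, hcov⟩ := ih ((s.erase i).erase j)
        (by rw [Finset.card_erase_of_mem hj', Finset.card_erase_of_mem hi]; omega)
        (fun u => by
          have h := hc u
          rw [hcard u, hcard (-u), haj] at h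
          have e1 : (-a i = u) ↔ (a i = -u) := neg_eq_iff_eq_neg
          have e2 : (-a i = -u) ↔ (a i = u) := neg_inj
          simp only [e1, e2] at h
          omega)
        (fun l hl m hm => hfix l (Finset.mem_of_mem_erase (Finset.mem_of_mem_erase hl)) m
          (Finset.mem_of_mem_erase (Finset.mem_of_mem_erase hm)))
      refine ⟨Fin.cons i p, Fin.cons j q, ?_, ?_⟩
      · intro l
        refine Fin.cases ?_ (fun l => ?_) l
        · simp [haj]
        · simpa using hpq l
      · intro l hl
        by_cases hli : l = i
        · exact ⟨0, Or.inl (by simpa using hli)⟩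
        by_cases hlj : l = j
        · exact ⟨0, Or.inr (by simpa using hlj)⟩
        obtain ⟨m, hm⟩ := hcov l (Finset.mem_erase.2 ⟨hlj, Finset.mem_erase.2 ⟨hli, hl⟩⟩)
        exact ⟨m.succ, by simpa using hm⟩
    · -- Here `i` is the only element with value `-a i`, so `a i = -a i` and `s = {i}` has odd size.
      exfalso
      push Not at hex
      have hpos : 0 < (s.filter fun l => a l = -a i).card := by
        rw [← hc (a i), Finset.card_pos]
        exact ⟨i, Finset.mem_filter.2 ⟨hi, rfl⟩⟩
      obtain ⟨j, hj⟩ := Finset.card_pos.1 hpos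
      obtain ⟨hjs, hja⟩ := Finset.mem_filter.1 hj
      have hji : j = i := by_contra fun h => hex j hjs h hja
      rw [hji] at hja
      have hsub : s ⊆ {i} := fun l hl => by
        rw [Finset.mem_singleton]
        by_contra h
        exact hex l hl h ((hfix i hi l hl hja).trans hja)
      have := Finset.card_le_card hsub
      rw [Finset.card_singleton] at this
      omega

/-- A unit modulo `N` equal to its negative exists only for `N ≤ 2`, when there is just one unit. -/
theorem ZMod.units_eq_of_eq_neg {N : ℕ} [NeZero N] {u : (ZMod N)ˣ} (h : u = -u)
    (v : (ZMod N)ˣ) : v = u := by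
  have h2 : (2 : ZMod N) = 0 := by
    have h1 : (u : ZMod N) = -u := by rw [← Units.val_neg, ← h]
    have : (2 : ZMod N) * u = 0 := by linear_combination h1
    exact (Units.mul_left_eq_zero u).1 this
  have hd : N ∣ 2 := (ZMod.natCast_eq_zero_iff 2 N).1 (by exact_mod_cast h2)
  have hle := Nat.le_of_dvd two_pos hd
  have h0 := NeZero.ne N
  obtain rfl | rfl : N = 1 ∨ N = 2 := by omega
  · exact Subsingleton.elim _ _
  · revert u v; decide

theorem exists_pairing_of_sum_sawtooth {N d : ℕ} [NeZero N] {ι : Type*} [Fintype ι]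
    (hι : Fintype.card ι = 2 * d)
    (a : ι → (ZMod N)ˣ) (h : ∀ g : ZMod N, ∑ i, sawtooth ((a i : ZMod N) * g) = 0) (i₀ : ι) :
    ∃ (e : Fin d ⊕ Fin d ≃ ι) (j₀ : Fin d), e (Sum.inr j₀) = i₀ ∧
      ∀ j, a (e (Sum.inl j)) = -a (e (Sum.inr j)) := by
  classical
  obtain ⟨p, q, hpq, hcov⟩ := exists_pairing_of_card_eq_card_neg a d Finset.univ
    (by rw [Finset.card_univ, hι])
    (fun u => by
      simpa only [Fintype.card_subtype] using card_eq_card_neg_of_sum_sawtooth a h u)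
    (fun i _ j _ hij => ZMod.units_eq_of_eq_neg hij _)
  have key : ∀ p q : Fin d → ι, (∀ i, ∃ j, i = p j ∨ i = q j) →
      Function.Bijective (Sum.elim p q) := by
    intro p q hcov
    rw [Fintype.bijective_iff_surjective_and_card]
    refine ⟨fun i => ?_, by simp [hι, two_mul]⟩
    obtain ⟨j, hj | hj⟩ := hcov i
    · exact ⟨Sum.inl j, hj.symm⟩
    · exact ⟨Sum.inr j, hj.symm⟩
  obtain ⟨j₀, hj | hj⟩ := hcov i₀ (Finset.mem_univ _)
  · exact ⟨Equiv.ofBijective _ (key q p fun i => by simpa [or_comm] using hcov i), j₀, hj.symm,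
      fun j => by simp [hpq]⟩
  · exact ⟨Equiv.ofBijective _ (key p q fun i => by simpa using hcov i), j₀, hj.symm,
      fun j => by simp [hpq]⟩

namespace GenWhite

/-! ### Overlattices of `ℤ^ι` whose nonintegral points have no integral coordinate -/


theorem mem_latticePoints_iff {ι : Type} {x : ι → ℝ} :
    x ∈ latticePoints ι ↔ ∀ i, ∃ m : ℤ, x i = m := by
  constructor
  · rintro ⟨z, rfl⟩ i
    exact ⟨z i, rfl⟩
  · intro h
    choose z hz using h
    exact ⟨z, funext fun i => (hz i).symm⟩

variable {ι : Type} {L : AddSubgroup (ι → ℝ)}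

/-- A group `L ⊇ ℤ^ι` with bounded denominators, in which one integral coordinate forces all of them to
be integral, is generated over `ℤ^ι` by a single vector `a / n` with all `a i` prime to `n`. -/
theorem exists_generator
    (hZ : latticePoints ι ⊆ L)
    (hinteg : ∀ x ∈ L, ∀ i, (∃ m : ℤ, x i = m) → x ∈ latticePoints ι)
    {D : ℤ} (hD : D ≠ 0) (hden : ∀ x ∈ L, ∀ i, ∃ m : ℤ, D * x i = m) (i₀ : ι) :
    ∃ (n : ℕ) (a : ι → ℤ), 0 < n ∧ a i₀ = 1 ∧ (∀ i, IsCoprime (a i) n) ∧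
      ∀ x, x ∈ L ↔ ∃ m : ℤ, (fun i => x i - m * (a i / n)) ∈ latticePoints ι := by
  classical
  wlog hDpos : 0 < D generalizing D
  · refine this (D := -D) (neg_ne_zero.2 hD) (fun x hx i => ?_) (by omega)
    obtain ⟨m, hm⟩ := hden x hx i
    exact ⟨-m, by push_cast; linarith⟩
  have hex : ∃ q : ℕ, 0 < q ∧ ∃ x ∈ L, D * x i₀ = q := by
    refine ⟨D.toNat, by omega, Pi.single i₀ 1, hZ ⟨Pi.single i₀ 1, ?_⟩, ?_⟩
    · ext i
      by_cases h : i = i₀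
      · subst h; simp
      · simp [h]
    · have : ((D.toNat : ℤ) : ℝ) = D := by rw [Int.toNat_of_nonneg hDpos.le]
      rw [Int.cast_natCast] at this
      rw [this, Pi.single_eq_same, mul_one]
  -- `g ∈ L` has the least positive coordinate at `i₀`, namely `q / D`.
  obtain ⟨hq, g, hg, hgq⟩ := Nat.find_spec hex
  set q := Nat.find hex
  have hmin : ∀ r : ℕ, 0 < r → (∃ x ∈ L, D * x i₀ = r) → q ≤ r := fun r h1 h2 =>
    Nat.find_min' hex ⟨h1, h2⟩
  have hdvd : ∀ x ∈ L, ∀ k : ℤ, D * x i₀ = k → (q : ℤ) ∣ k := by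
    intro x hx k hk
    have hq' : (0 : ℤ) < q := by exact_mod_cast hq
    by_contra hnd
    have h0 : 0 ≤ k % q := Int.emod_nonneg _ hq'.ne'
    have hlt : k % q < q := Int.emod_lt_of_pos _ hq'
    have hne : k % q ≠ 0 := fun h => hnd (Int.dvd_of_emod_eq_zero h)
    have := hmin (k % q).toNat (by omega) ⟨x - (k / q) • g, L.sub_mem hx (L.zsmul_mem hg _), by
      have e1 : (((k % q).toNat : ℤ) : ℝ) = ((k % q : ℤ) : ℝ) := by rw [Int.toNat_of_nonneg h0]
      have e2 : ((k % q : ℤ) : ℝ) = k - (k / q : ℤ) * q := by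
        have := Int.emod_add_mul_ediv k q
        have h' : ((k % q + q * (k / q) : ℤ) : ℝ) = k := by rw [this]
        push_cast at h'
        linarith
      rw [Int.cast_natCast] at e1
      rw [e1, e2, ← hk, ← hgq]
      simp
      ring⟩
    omega
  obtain ⟨n', hn'⟩ := hdvd (Pi.single i₀ 1) (hZ ⟨Pi.single i₀ 1, by
    ext i
    by_cases h : i = i₀
    · subst h; simp
    · simp [h]⟩) D (by simp)
  have hn'pos : 0 < n' := by
    have : (0 : ℤ) < q := by exact_mod_cast hq
    exact pos_of_mul_pos_right (hn' ▸ hDpos) this.le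
  obtain ⟨n, rfl⟩ : ∃ n : ℕ, n' = n := ⟨n'.toNat, by omega⟩
  have hn : 0 < n := by exact_mod_cast hn'pos
  have hnR : (n : ℝ) ≠ 0 := by exact_mod_cast hn.ne'
  have hqR : (q : ℝ) ≠ 0 := by exact_mod_cast hq.ne'
  have hDR : (D : ℝ) = q * n := by rw [hn']; push_cast; ring
  have hg0 : (n : ℝ) * g i₀ = 1 := by
    rw [hDR] at hgq
    apply mul_left_cancel₀ hqR
    linarith
  obtain ⟨a, ha⟩ := hinteg (n • g) (L.nsmul_mem hg n) i₀ ⟨1, by simpa using hg0⟩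
  have hai : ∀ i, (a i : ℝ) = n * g i := fun i => by
    have := congrFun ha i
    simpa using this
  have hgi : ∀ i, (a i : ℝ) / n = g i := fun i => by rw [hai]; field_simp
  refine ⟨n, a, hn, ?_, ?_, ?_⟩
  · have := hai i₀
    rw [hg0] at this
    exact_mod_cast this
  · intro i
    rw [Int.isCoprime_iff_gcd_eq_one]
    obtain ⟨a', ha'⟩ := Int.gcd_dvd_left (a := a i) (b := n)
    obtain ⟨m, hm⟩ := Int.gcd_dvd_right (a := a i) (b := n)
    set e := Int.gcd (a i) n
    have he : (e : ℝ) ≠ 0 := by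
      intro h
      have : e = 0 := by exact_mod_cast h
      rw [this] at hm
      simp at hm
      omega
    have hmR : (n : ℝ) = e * m := by exact_mod_cast hm
    have haR : (a i : ℝ) = e * a' := by exact_mod_cast ha'
    -- If `e` divides `a i` and `n`, then `(n / e) • g` is integral at `i`, hence everywhere; but its
    -- coordinate at `i₀` is `1 / e`.
    have hmem := hinteg (m • g) (L.zsmul_mem hg m) i ⟨a', by
      have h1 := hai i
      rw [hmR, haR] at h1
      have : (a' : ℝ) = m * g i := by
        apply mul_left_cancel₀ he
        linarith
      simp [this]⟩
    obtain ⟨c, hc⟩ := mem_latticePoints_iff.1 hmem i₀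
    have hc' : (m : ℝ) * g i₀ = c := by simpa using hc
    have h1 : (e : ℝ) * c = 1 := by rw [← hc', ← hg0, hmR]; ring
    have h2 : (e : ℤ) * c = 1 := by exact_mod_cast h1
    have h3 := Int.eq_one_or_neg_one_of_mul_eq_one h2
    omega
  · intro x
    constructor
    · intro hx
      obtain ⟨k, hk⟩ := hden x hx i₀
      obtain ⟨m, rfl⟩ := hdvd x hx k hk
      refine ⟨m, ?_⟩
      simp_rw [hgi]
      have hmem : x - m • g ∈ L := L.sub_mem hx (L.zsmul_mem hg m)
      have := hinteg _ hmem i₀ ⟨0, by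
        have : (q : ℝ) * n * x i₀ = q * m := by rw [← hDR, hk]; push_cast; ring
        have h2 : (n : ℝ) * x i₀ = m := by
          apply mul_left_cancel₀ hqR
          linarith
        have h3 : (n : ℝ) * (x i₀ - m * g i₀) = 0 := by
          linear_combination h2 - m * hg0
        simpa using (mul_eq_zero.1 h3).resolve_left hnR⟩
      convert this using 1
      ext i
      simp
    · rintro ⟨m, hm⟩
      have := L.add_mem (hZ hm) (L.zsmul_mem hg m)
      convert this using 1
      ext i
      simp [hgi]

/-- The lower bound `d` for the sum of the fractional parts holds for `x` and for `-x`, and the two sums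
add up to `2 * d`. -/
theorem sum_fract_eq [Fintype ι] {d : ℕ} (hι : Fintype.card ι = 2 * d)
    (hZ : latticePoints ι ⊆ L)
    (hinteg : ∀ x ∈ L, ∀ i, (∃ m : ℤ, x i = m) → x ∈ latticePoints ι)
    (hpos : ∀ x ∈ L, (∀ i, 0 < x i) → (d : ℝ) ≤ ∑ i, x i)
    {x : ι → ℝ} (hx : x ∈ L) (hxZ : x ∉ latticePoints ι) :
    ∑ i, Int.fract (x i) = d := by
  have hlow : ∀ x ∈ L, x ∉ latticePoints ι → (d : ℝ) ≤ ∑ i, Int.fract (x i) := by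
    intro x hx hxZ
    refine hpos (fun i => Int.fract (x i)) ?_ fun i => ?_
    · exact L.sub_mem hx (hZ ⟨fun i => ⌊x i⌋, rfl⟩)
    · refine lt_of_le_of_ne (Int.fract_nonneg _) fun h => ?_
      have : x i = ⌊x i⌋ := (sub_eq_zero.1 h.symm)
      exact hxZ (hinteg x hx i ⟨_, this⟩)
  have h1 := hlow x hx hxZ
  have h2 := hlow (-x) (L.neg_mem hx) fun h => hxZ (by
    rw [mem_latticePoints_iff] at h ⊢
    intro i
    obtain ⟨m, hm⟩ := h i
    exact ⟨-m, by rw [Pi.neg_apply] at hm; push_cast; linarith⟩)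
  have h3 : ∀ i, Int.fract ((-x) i) = 1 - Int.fract (x i) := fun i =>
    Int.fract_neg fun h => hxZ (hinteg x hx i ⟨⌊x i⌋, sub_eq_zero.1 h⟩)
  simp_rw [h3, Finset.sum_sub_distrib, Finset.sum_const, Finset.card_univ, hι, nsmul_eq_mul] at h2
  push_cast at h2
  linarith

/-- Translation of the fractional part sums over the multiples of `a / n` to the sawtooth function. -/
theorem sum_sawtooth_eq_zero [Fintype ι] {d n : ℕ} [NeZero n] (hι : Fintype.card ι = 2 * d)
    (a : ι → ℤ) (u : ι → (ZMod n)ˣ) (hu : ∀ i, (u i : ZMod n) = a i)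
    (h : ∀ k : ℕ, 0 < k → k < n → ∑ i, Int.fract ((k * a i : ℤ) / n : ℝ) = d) (g : ZMod n) :
    ∑ i, sawtooth ((u i : ZMod n) * g) = 0 := by
  by_cases hg : g = 0
  · simp [hg, sawtooth]
  have hk := h g.val (ZMod.val_pos.2 hg) g.val_lt
  have hsaw : ∀ i, sawtooth ((u i : ZMod n) * g) =
      ((Int.fract (((g.val : ℤ) * a i : ℤ) / n : ℝ) : ℝ) : ℂ) - 1 / 2 := by
    intro i
    have hne : (u i : ZMod n) * g ≠ 0 := by
      rw [Ne, Units.mul_right_eq_zero]; exact hg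
    have hcast : (u i : ZMod n) * g = (((g.val : ℤ) * a i : ℤ) : ZMod n) := by
      push_cast
      rw [ZMod.natCast_zmod_val, hu, mul_comm]
    have hval : ((((u i : ZMod n) * g).val : ℤ) : ℝ) = (((g.val : ℤ) * a i) % n : ℤ) := by
      rw [hcast, ZMod.val_intCast]
    rw [sawtooth, if_neg hne, Int.fract_div_intCast_eq_div_intCast_mod, ← hval]
    push_cast
    rfl
  simp_rw [hsaw, Finset.sum_sub_distrib, Finset.sum_const, Finset.card_univ, hι]
  rw [← Complex.ofReal_sum, hk]
  simp
  ring


/-! ### Coordinates adapted to a pairing -/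


/-- Coordinates adapted to a pairing `e` of the index set and the generator `a / n` of a lattice. The
first block consists of the sums over the pairs. The second is built from `t j = x (e (inr j))`: it is
`n * t j₀` at `j₀` and `t j - a j * t j₀` elsewhere (with `a j` short for
`a (e (inr j))`), the coordinates with respect to `a / n` and the
unit vectors other than the one at `j₀`; they form a lattice basis when `a j₀ = 1`. -/
def pairedCoordinates {d : ℕ} (e : Fin d ⊕ Fin d ≃ ι) (j₀ : Fin d) (n : ℕ) (a : ι → ℤ) :
    (ι → ℝ) →ₗ[ℝ] (Fin d ⊕ Fin d → ℝ) where
  toFun x := Sum.elim (fun j => x (e (.inl j)) + x (e (.inr j)))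
    (fun j => if j = j₀ then n * x (e (.inr j₀))
      else x (e (.inr j)) - a (e (.inr j)) * x (e (.inr j₀)))
  map_add' x y := by
    ext (j | j)
    · simp; ring
    · simp only [Sum.elim_inr, Pi.add_apply]
      split_ifs <;> ring
  map_smul' c x := by
    ext (j | j)
    · simp; ring
    · simp only [Sum.elim_inr, Pi.smul_apply, smul_eq_mul, RingHom.id_apply]
      split_ifs <;> ring

section
variable {d : ℕ} (e : Fin d ⊕ Fin d ≃ ι) (j₀ : Fin d) (n : ℕ) (a : ι → ℤ)

theorem pairedCoordinates_inl (x : ι → ℝ) (j : Fin d) :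
    pairedCoordinates e j₀ n a x (.inl j) = x (e (.inl j)) + x (e (.inr j)) := rfl

theorem pairedCoordinates_inr (x : ι → ℝ) (j : Fin d) :
    pairedCoordinates e j₀ n a x (.inr j) = if j = j₀ then n * x (e (.inr j₀))
      else x (e (.inr j)) - a (e (.inr j)) * x (e (.inr j₀)) := rfl

theorem pairedCoordinates_injective (hn : 0 < n) :
    Function.Injective (pairedCoordinates e j₀ n a) := by
  rw [← LinearMap.ker_eq_bot, LinearMap.ker_eq_bot']
  intro x hx
  have hnR : (n : ℝ) ≠ 0 := by exact_mod_cast hn.ne'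
  have h0 : x (e (.inr j₀)) = 0 := by
    have := congrFun hx (.inr j₀)
    rw [pairedCoordinates_inr, if_pos rfl] at this
    exact (mul_eq_zero.1 this).resolve_left hnR
  have h1 : ∀ j, x (e (.inr j)) = 0 := by
    intro j
    by_cases hj : j = j₀
    · rw [hj, h0]
    · have := congrFun hx (.inr j)
      rwa [pairedCoordinates_inr, if_neg hj, h0, mul_zero, sub_zero] at this
  ext i
  obtain ⟨j | j, rfl⟩ := e.surjective i
  · have := congrFun hx (.inl j)
    rwa [pairedCoordinates_inl, h1, add_zero] at this
  · exact h1 j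

/-- The paired coordinates identify the lattice `ℤ^ι + ℤ · (a / n)` with the standard lattice. -/
theorem pairedCoordinates_mem_latticePoints_iff (hn : 0 < n)
    (ha₀ : a (e (.inr j₀)) = 1)
    (hpair : ∀ j, (n : ℤ) ∣ a (e (.inl j)) + a (e (.inr j)))
    (hL : ∀ x, x ∈ L ↔ ∃ m : ℤ, (fun i => x i - m * (a i / n)) ∈ latticePoints ι)
    (x : ι → ℝ) :
    pairedCoordinates e j₀ n a x ∈ latticePoints (Fin d ⊕ Fin d) ↔ x ∈ L := by
  have hnR : (n : ℝ) ≠ 0 := by exact_mod_cast hn.ne'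
  choose c hc using hpair
  have hcR : ∀ j, (a (e (.inl j)) + a (e (.inr j)) : ℝ) = n * c j := fun j => by
    exact_mod_cast hc j
  rw [hL]
  constructor
  · rintro ⟨z, hz⟩
    have hz0 : (z (.inr j₀) : ℝ) = n * x (e (.inr j₀)) := by
      have := congrFun hz (.inr j₀)
      rwa [pairedCoordinates_inr, if_pos rfl] at this
    have h1 : ∀ j, ∃ m : ℤ, x (e (.inr j)) - z (.inr j₀) * (a (e (.inr j)) / n) = m := by
      intro j
      by_cases hj : j = j₀
      · refine ⟨0, ?_⟩
        rw [hj, ha₀, hz0]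
        field_simp
        simp
      · refine ⟨z (.inr j), ?_⟩
        have : (z (.inr j) : ℝ) = _ := congrFun hz (.inr j)
        rw [pairedCoordinates_inr, if_neg hj] at this
        rw [this, hz0]
        field_simp
    refine ⟨z (.inr j₀), mem_latticePoints_iff.2 fun i => ?_⟩
    obtain ⟨j | j, rfl⟩ := e.surjective i
    · obtain ⟨m, hm⟩ := h1 j
      refine ⟨z (.inl j) - m - z (.inr j₀) * c j, ?_⟩
      have h2 : (z (.inl j) : ℝ) = x (e (.inl j)) + x (e (.inr j)) := congrFun hz (.inl j)
      push_cast
      rw [← hm, h2]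
      have h3 : (a (e (.inl j)) : ℝ) = n * c j - a (e (.inr j)) := by rw [← hcR]; ring
      rw [h3]
      field_simp
      ring
    · exact h1 j
  · rintro ⟨m, z, hz⟩
    have hx : ∀ i, x i = z i + m * (a i / n) := fun i => by
      have := congrFun hz i
      simp only at this
      linarith
    rw [mem_latticePoints_iff]
    rintro (j | j)
    · refine ⟨z (e (.inl j)) + z (e (.inr j)) + m * c j, ?_⟩
      rw [pairedCoordinates_inl, hx, hx]
      have h3 : (a (e (.inl j)) : ℝ) = n * c j - a (e (.inr j)) := by rw [← hcR]; ring
      rw [h3]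
      push_cast
      field_simp
      ring
    · rw [pairedCoordinates_inr]
      split_ifs with hj
      · refine ⟨n * z (e (.inr j₀)) + m, ?_⟩
        rw [hx, ha₀]
        push_cast
        field_simp
      · refine ⟨z (e (.inr j)) - a (e (.inr j)) * z (e (.inr j₀)), ?_⟩
        rw [hx, hx (e (.inr j₀)), ha₀]
        push_cast
        field_simp
        ring

theorem pairedCoordinates_single_inl [DecidableEq ι] (j : Fin d) :
    pairedCoordinates e j₀ n a (Pi.single (e (.inl j)) 1) =
      Sum.elim (Pi.single j 1) 0 := by
  ext (l | l)
  · rw [pairedCoordinates_inl]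
    by_cases h : l = j
    · subst h; simp
    · simp [h]
  · rw [pairedCoordinates_inr]
    simp

theorem pairedCoordinates_single_inr_inl [DecidableEq ι] (j l : Fin d) :
    pairedCoordinates e j₀ n a (Pi.single (e (.inr j)) 1) (.inl l) =
      (Pi.single j 1 : Fin d → ℝ) l := by
  rw [pairedCoordinates_inl]
  by_cases h : l = j
  · subst h; simp
  · simp [h]

end

/-- The linear form of the main construction: a lattice `L` with the listed properties is carried onto
`ℤ^d × ℤ^d` by a linear map that sends the two unit vectors of each pair over the same `e_j`. -/
theorem exists_paired_coordinates [Fintype ι] [DecidableEq ι] {d : ℕ}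
    (hι : Fintype.card ι = 2 * d) (hd : 1 ≤ d)
    (hZ : latticePoints ι ⊆ L)
    (hinteg : ∀ x ∈ L, ∀ i, (∃ m : ℤ, x i = m) → x ∈ latticePoints ι)
    {D : ℤ} (hD : D ≠ 0) (hden : ∀ x ∈ L, ∀ i, ∃ m : ℤ, D * x i = m)
    (hpos : ∀ x ∈ L, (∀ i, 0 < x i) → (d : ℝ) ≤ ∑ i, x i) :
    ∃ (e : Fin d ⊕ Fin d ≃ ι) (F : (ι → ℝ) →ₗ[ℝ] (Fin d ⊕ Fin d → ℝ)),
      Function.Injective F ∧ (∀ x, F x ∈ latticePoints (Fin d ⊕ Fin d) ↔ x ∈ L) ∧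
      (∀ j, F (Pi.single (e (.inl j)) 1) = Sum.elim (Pi.single j 1) 0) ∧
      ∀ j l, F (Pi.single (e (.inr j)) 1) (.inl l) = (Pi.single j 1 : Fin d → ℝ) l := by
  obtain ⟨i₀⟩ : Nonempty ι := Fintype.card_pos_iff.1 (by omega)
  obtain ⟨n, a, hn, ha₀, hcop, hL⟩ := exists_generator hZ hinteg hD hden i₀
  have : NeZero n := ⟨hn.ne'⟩
  have hnR : (n : ℝ) ≠ 0 := by exact_mod_cast hn.ne'
  have hunit : ∀ i, IsUnit (a i : ZMod n) := fun i => by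
    obtain ⟨p, q, hpq⟩ := hcop i
    have := congrArg (Int.cast : ℤ → ZMod n) hpq
    push_cast at this
    rw [ZMod.natCast_self, mul_zero, add_zero] at this
    exact IsUnit.of_mul_eq_one_right _ this
  choose u hu using hunit
  have hsaw := sum_sawtooth_eq_zero hι a u hu fun k hk0 hkn => by
    have := sum_fract_eq hι hZ hinteg hpos (x := fun i => ((k * a i : ℤ) / n : ℝ))
      ((hL _).2 ⟨k, mem_latticePoints_iff.2 fun i => ⟨0, by push_cast; ring⟩⟩)
      (fun h => by
        obtain ⟨m, hm⟩ := mem_latticePoints_iff.1 h i₀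
        simp only [ha₀, mul_one] at hm
        rw [div_eq_iff hnR] at hm
        have hm' : (k : ℤ) = m * n := by exact_mod_cast hm
        have hle := Int.le_of_dvd (by omega) (Dvd.intro_left m hm'.symm)
        omega)
    exact this
  obtain ⟨e, j₀, he, hpair⟩ := exists_pairing_of_sum_sawtooth hι u hsaw i₀
  subst he
  refine ⟨e, pairedCoordinates e j₀ n a, pairedCoordinates_injective e j₀ n a hn,
    pairedCoordinates_mem_latticePoints_iff e j₀ n a hn ha₀ (fun j => ?_) hL,
    pairedCoordinates_single_inl e j₀ n a, pairedCoordinates_single_inr_inl e j₀ n a⟩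
  rw [← ZMod.intCast_zmod_eq_zero_iff_dvd]
  push_cast
  rw [← hu, ← hu, hpair, Units.val_neg, neg_add_cancel]


/-! ### The lattice of the cone over a simplex -/


theorem latticePoints_add {ι : Type} {x y : ι → ℝ} (hx : x ∈ latticePoints ι)
    (hy : y ∈ latticePoints ι) : x + y ∈ latticePoints ι := by
  obtain ⟨u, rfl⟩ := hx
  obtain ⟨v, rfl⟩ := hy
  exact ⟨u + v, by ext; simp⟩

theorem latticePoints_zsmul {ι : Type} {x : ι → ℝ} (hx : x ∈ latticePoints ι) (m : ℤ) :
    (m : ℝ) • x ∈ latticePoints ι := by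
  obtain ⟨u, rfl⟩ := hx
  exact ⟨m • u, by ext; simp⟩

theorem latticePoints_sub {ι : Type} {x y : ι → ℝ} (hx : x ∈ latticePoints ι)
    (hy : y ∈ latticePoints ι) : x - y ∈ latticePoints ι := by
  have := latticePoints_add hx (latticePoints_zsmul hy (-1))
  rwa [Int.cast_neg, Int.cast_one, neg_one_smul, ← sub_eq_add_neg] at this

theorem latticePoints_zero {ι : Type} : (0 : ι → ℝ) ∈ latticePoints ι := ⟨0, by ext; simp⟩

theorem latticePoints_sum {ι κ : Type} (t : Finset κ) {f : κ → ι → ℝ}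
    (h : ∀ i ∈ t, f i ∈ latticePoints ι) : ∑ i ∈ t, f i ∈ latticePoints ι := by
  classical
  induction t using Finset.induction_on with
  | empty => simpa using latticePoints_zero
  | insert a t ha ih =>
    rw [Finset.sum_insert ha]
    exact latticePoints_add (h a (Finset.mem_insert_self _ _))
      (ih fun i hi => h i (Finset.mem_insert_of_mem hi))

/-- The lattice of the cone over the points `v i` placed at height `1`, written in the coordinates given
by these points: all `x` for which both the height `∑ x i` and the vector `∑ x i • v i` are integral. -/
def coneLattice {κ : Type} [Fintype κ] {n : ℕ} (v : κ → Fin n → ℝ) : AddSubgroup (κ → ℝ) where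
  carrier := {x | (∃ h : ℤ, ∑ i, x i = h) ∧ ∑ i, x i • v i ∈ latticePoints (Fin n)}
  zero_mem' := ⟨⟨0, by simp⟩, by simpa using latticePoints_zero⟩
  add_mem' := by
    rintro x y ⟨⟨h, hx⟩, hx'⟩ ⟨⟨k, hy⟩, hy'⟩
    refine ⟨⟨h + k, by simp [Finset.sum_add_distrib, hx, hy]⟩, ?_⟩
    simpa [add_smul, Finset.sum_add_distrib] using latticePoints_add hx' hy'
  neg_mem' := by
    rintro x ⟨⟨h, hx⟩, hx'⟩
    refine ⟨⟨-h, by simp [hx]⟩, ?_⟩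
    simpa using latticePoints_zsmul hx' (-1)

theorem mem_coneLattice {κ : Type} [Fintype κ] {n : ℕ} {v : κ → Fin n → ℝ} {x : κ → ℝ} :
    x ∈ coneLattice v ↔ (∃ h : ℤ, ∑ i, x i = h) ∧ ∑ i, x i • v i ∈ latticePoints (Fin n) :=
  Iff.rfl

theorem latticePoints_subset_coneLattice {κ : Type} [Fintype κ] {n : ℕ} {v : κ → Fin n → ℝ}
    (hv : ∀ i, v i ∈ latticePoints (Fin n)) : latticePoints κ ⊆ coneLattice v := by
  rintro _ ⟨z, rfl⟩
  exact ⟨⟨∑ i, z i, by simp⟩, latticePoints_sum _ fun i _ => latticePoints_zsmul (hv i) _⟩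

/-- Real coefficients of a lattice point with respect to part of a lattice basis are integers. -/
theorem basis_coefficients_int {n k : ℕ} (b : Module.Basis (Fin n) ℤ (Fin n → ℤ))
    (e : Fin k ↪ Fin n) (c : Fin k → ℝ)
    (h : ∑ i, c i • (fun j => (b (e i) j : ℝ)) ∈ latticePoints (Fin n)) (i : Fin k) :
    ∃ m : ℤ, c i = m := by
  -- The integral coordinate form dual to `b (e i)`, extended to real vectors.
  let φ : (Fin n → ℝ) →ₗ[ℝ] ℝ :=
    Fintype.linearCombination ℝ fun j => (b.coord (e i) (Pi.single j 1) : ℝ)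
  have hφ : ∀ z : Fin n → ℤ, φ (fun j => (z j : ℝ)) = (b.coord (e i) z : ℤ) := by
    intro z
    have hz : z = ∑ j, z j • (Pi.single j 1 : Fin n → ℤ) := by
      ext l
      simp [Finset.sum_apply, Pi.single_apply]
    conv_rhs => rw [hz, map_sum]
    simp only [φ, Fintype.linearCombination_apply, map_smul, smul_eq_mul]
    push_cast
    rfl
  obtain ⟨z, hz⟩ := h
  have h1 := hφ z
  have h2 : φ (fun j => (z j : ℝ)) = c i := by
    have : (fun j => (z j : ℝ)) = _ := hz
    rw [this, map_sum]
    simp only [map_smul, hφ, smul_eq_mul, Module.Basis.coord_apply, Module.Basis.repr_self]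
    rw [Finset.sum_eq_single i]
    · simp
    · intro l _ hl
      rw [Finsupp.single_eq_of_ne (by simpa using hl.symm)]
      simp
    · simp
  exact ⟨_, h2.symm.trans h1⟩

theorem IsBasicSimplex.coefficients_int {n k : ℕ} {s : Affine.Simplex ℝ (Fin n → ℝ) k}
    (hs : IsBasicSimplex s) (c : Fin (k + 1) → ℝ) (hsum : ∃ h : ℤ, ∑ i, c i = h)
    (h : ∑ i, c i • s.points i ∈ latticePoints (Fin n)) (i : Fin (k + 1)) :
    ∃ m : ℤ, c i = m := by
  obtain ⟨hlat, b, e, hb⟩ := hs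
  obtain ⟨N, hN⟩ := hsum
  have key : ∀ i : Fin k, ∃ m : ℤ, c i.castSucc = m := by
    apply basis_coefficients_int b e
    have : ∑ i : Fin k, c i.castSucc • (fun j => (b (e i) j : ℝ)) =
        ∑ i, c i • s.points i - (N : ℝ) • s.points (Fin.last k) := by
      simp_rw [← hb, smul_sub, Finset.sum_sub_distrib, ← Finset.sum_smul, ← hN,
        Fin.sum_univ_castSucc, add_smul]
      abel
    rw [this]
    exact latticePoints_sub h (latticePoints_zsmul (hlat _) N)
  refine Fin.lastCases ?_ key i
  choose m hm using key
  refine ⟨N - ∑ i, m i, ?_⟩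
  rw [Fin.sum_univ_castSucc] at hN
  push_cast
  simp_rw [← hm]
  linarith

/-- Basic facets: removing an integral coordinate leaves an integral combination of the vertices of the
opposite facet. -/
theorem FacetsBasic.mem_latticePoints {n : ℕ} (hn : 1 ≤ n) {s : Affine.Simplex ℝ (Fin n → ℝ) n}
    (hlat : IsLatticeSimplex s) (hs : FacetsBasic s) {x : Fin (n + 1) → ℝ}
    (hx : x ∈ coneLattice s.points) (j : Fin (n + 1)) (hj : ∃ m : ℤ, x j = m) :
    x ∈ latticePoints (Fin (n + 1)) := by
  obtain ⟨⟨N, hN⟩, hmem⟩ := hx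
  obtain ⟨m, hm⟩ := hj
  have hcard : (Finset.univ.erase j).card = (n - 1) + 1 := by
    rw [Finset.card_erase_of_mem (Finset.mem_univ j), Finset.card_univ, Fintype.card_fin]
    omega
  have hbasic := hs (n - 1) (Finset.univ.erase j) hcard (by omega)
  have hreindex : ∀ {M : Type} [AddCommGroup M] (f : Fin (n + 1) → M),
      ∑ i, f ((Finset.univ.erase j).orderEmbOfFin hcard i) = ∑ i, f i - f j := by
    intro M _ f
    rw [← Finset.sum_erase_eq_sub (Finset.mem_univ j)]
    conv_rhs => rw [← Finset.map_orderEmbOfFin_univ (Finset.univ.erase j) hcard]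
    rw [Finset.sum_map]
    rfl
  have hinteg := hbasic.coefficients_int
    (fun i => x ((Finset.univ.erase j).orderEmbOfFin hcard i))
    ⟨N - m, by rw [hreindex x, hN, hm]; push_cast; rfl⟩
    (by
      simp only [Affine.Simplex.face_points]
      rw [hreindex fun i => x i • s.points i, hm]
      exact latticePoints_sub hmem (latticePoints_zsmul (hlat j) m))
  rw [mem_latticePoints_iff]
  intro i
  by_cases hij : i = j
  · exact ⟨m, hij ▸ hm⟩
  · have hi : i ∈ Set.range ((Finset.univ.erase j).orderEmbOfFin hcard) := by
      rw [Finset.range_orderEmbOfFin]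
      simpa using hij
    obtain ⟨l, rfl⟩ := hi
    exact hinteg l

/-- Cramer's rule for the integral matrix with rows `(1, v_i)`. -/
theorem exists_common_denominator {n : ℕ} {s : Affine.Simplex ℝ (Fin n → ℝ) n}
    (hlat : IsLatticeSimplex s) :
    ∃ D : ℤ, D ≠ 0 ∧ ∀ x ∈ coneLattice s.points, ∀ i, ∃ m : ℤ, D * x i = m := by
  choose v hv using hlat
  have hv' : ∀ i j, s.points i j = v i j := fun i j => (congrFun (hv i) j).symm
  let M : Matrix (Fin (n + 1)) (Fin (n + 1)) ℤ := fun i => Fin.cons 1 (v i)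
  let MR : Matrix (Fin (n + 1)) (Fin (n + 1)) ℝ := (Int.castRingHom ℝ).mapMatrix M
  have hMR : ∀ i l, MR i l = ((Fin.cons 1 (v i) : Fin (n + 1) → ℤ) l : ℝ) := fun _ _ => rfl
  have hvec0 : ∀ x, Matrix.vecMul x MR 0 = ∑ i, x i := fun x => by
    simp [Matrix.vecMul, dotProduct, hMR]
  have hvecS : ∀ x j, Matrix.vecMul x MR (Fin.succ j) = (∑ i, x i • s.points i) j := fun x j => by
    simp [Matrix.vecMul, dotProduct, hMR, Finset.sum_apply, hv']
  have hdet : MR.det = (M.det : ℝ) := ((Int.castRingHom ℝ).map_det M).symm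
  refine ⟨M.det, fun h0 => ?_, fun x hx i => ?_⟩
  · have : MR.det = 0 := by rw [hdet, h0, Int.cast_zero]
    obtain ⟨x, hx0, hx⟩ := Matrix.exists_vecMul_eq_zero_iff.2 this
    refine hx0 (funext fun i => affineIndependent_iff.1 s.independent Finset.univ x ?_ ?_ i
      (Finset.mem_univ i))
    · rw [← hvec0, hx]; rfl
    · ext j
      rw [← hvecS, hx]; rfl
  · obtain ⟨⟨N, hN⟩, z, hz⟩ := hx
    have hxM : Matrix.vecMul x MR = fun l => (((Fin.cons N z : Fin (n + 1) → ℤ) l : ℤ) : ℝ) := by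
      ext l
      refine Fin.cases ?_ (fun l => ?_) l
      · rw [hvec0, hN]; simp
      · rw [hvecS, ← hz]; simp
    have hadj : MR.adjugate = (Int.castRingHom ℝ).mapMatrix M.adjugate :=
      ((Int.castRingHom ℝ).map_adjugate M).symm
    have h1 : Matrix.vecMul (Matrix.vecMul x MR) MR.adjugate = MR.det • x := by
      rw [Matrix.vecMul_vecMul, Matrix.mul_adjugate, Matrix.vecMul_smul, Matrix.vecMul_one]
    refine ⟨Matrix.vecMul (Fin.cons N z) M.adjugate i, ?_⟩
    have h2 := congrFun h1 i
    rw [hxM, hadj, hdet] at h2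
    rw [Pi.smul_apply, smul_eq_mul] at h2
    rw [← h2]
    simp [Matrix.vecMul, dotProduct]

/-- The vertices of a full-dimensional simplex as an affine basis. -/
noncomputable def vertexBasis {n : ℕ} (s : Affine.Simplex ℝ (Fin n → ℝ) n) :
    AffineBasis (Fin (n + 1)) ℝ (Fin n → ℝ) :=
  ⟨s.points, s.independent, by
    rw [s.independent.affineSpan_eq_top_iff_card_eq_finrank_add_one]; simp⟩

theorem coe_vertexBasis {n : ℕ} (s : Affine.Simplex ℝ (Fin n → ℝ) n) :
    ⇑(vertexBasis s) = s.points := rfl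

theorem sum_smul_mem_interior_smul_body {n : ℕ} (s : Affine.Simplex ℝ (Fin n → ℝ) n)
    {x : Fin (n + 1) → ℝ} (hx : ∀ i, 0 < x i) :
    ∑ i, x i • s.points i ∈ interior ((∑ i, x i) • body s) := by
  set k := ∑ i, x i with hk
  have hkpos : 0 < k := Finset.sum_pos (fun i _ => hx i) Finset.univ_nonempty
  rw [interior_smul₀ hkpos.ne']
  have hw : ∑ i, k⁻¹ * x i = 1 := by rw [← Finset.mul_sum, ← hk, inv_mul_cancel₀ hkpos.ne']
  refine ⟨∑ i, (k⁻¹ * x i) • s.points i, ?_, ?_⟩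
  · rw [body, ← coe_vertexBasis, (vertexBasis s).interior_convexHull]
    intro i
    rw [← Finset.univ.affineCombination_eq_linear_combination _ _ hw,
      (vertexBasis s).coord_apply_combination_of_mem (Finset.mem_univ i) hw]
    exact mul_pos (inv_pos.2 hkpos) (hx i)
  · simp only [Finset.smul_sum, smul_smul]
    refine Finset.sum_congr rfl fun i _ => ?_
    rw [mul_inv_cancel_left₀ hkpos.ne']

/-- A positive point of the cone lattice at height `k` is an interior lattice point of `k Δ`. -/
theorem le_sum_of_no_interior_points {d n : ℕ} {s : Affine.Simplex ℝ (Fin n → ℝ) n}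
    (h : ∀ k : ℕ, 1 ≤ k → k ≤ d - 1 →
      interior ((k : ℝ) • body s) ∩ latticePoints (Fin n) = ∅)
    {x : Fin (n + 1) → ℝ} (hx : x ∈ coneLattice s.points) (hpos : ∀ i, 0 < x i) :
    (d : ℝ) ≤ ∑ i, x i := by
  obtain ⟨⟨N, hN⟩, hmem⟩ := hx
  have hsum : 0 < ∑ i, x i := Finset.sum_pos (fun i _ => hpos i) Finset.univ_nonempty
  have hNpos : 0 < N := by rw [hN] at hsum; exact_mod_cast hsum
  by_contra hlt
  push Not at hlt
  rw [hN] at hlt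
  have hlt' : N < d := by exact_mod_cast hlt
  have hcast : ((N.toNat : ℕ) : ℝ) = ∑ i, x i := by
    rw [hN, ← Int.cast_natCast, Int.toNat_of_nonneg hNpos.le]
  have hmem' : ∑ i, x i • s.points i ∈
      interior (((N.toNat : ℕ) : ℝ) • body s) ∩ latticePoints (Fin n) := by
    rw [hcast]
    exact ⟨sum_smul_mem_interior_smul_body s hpos, hmem⟩
  rw [h N.toNat (by omega) (by omega)] at hmem'
  exact hmem'

theorem affineSpan_body {n : ℕ} (s : Affine.Simplex ℝ (Fin n → ℝ) n) :
    affineSpan ℝ (body s) = ⊤ := by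
  rw [body, affineSpan_convexHull]
  exact (vertexBasis s).tot

/-- The Cayley polytope is the convex hull of the lifted vertices. -/
theorem cayley_segments {d : ℕ} (S : Fin d → Affine.Simplex ℝ (Fin d → ℝ) 1) :
    cayley (fun i => body (S i)) =
      convexHull ℝ (⋃ i, (fun x : Fin d → ℝ => Sum.elim (Pi.single i (1 : ℝ)) x) ''
        Set.range (S i).points) := by
  have hφ : ∀ i, ∃ φ : (Fin d → ℝ) →ᵃ[ℝ] (Fin d ⊕ Fin d → ℝ),
      ⇑φ = fun x : Fin d → ℝ => Sum.elim (Pi.single i (1 : ℝ)) x := fun i =>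
    ⟨{ toFun := fun x => Sum.elim (Pi.single i (1 : ℝ)) x
       linear :=
        { toFun := fun x => Sum.elim 0 x
          map_add' := fun x y => by ext (l | l) <;> simp
          map_smul' := fun c x => by ext (l | l) <;> simp }
       map_vadd' := fun p v => by ext (l | l) <;> simp }, rfl⟩
  apply Set.Subset.antisymm
  · refine convexHull_min (Set.iUnion_subset fun i => ?_) (convex_convexHull ℝ _)
    obtain ⟨φ, hφ⟩ := hφ i
    change (fun x : Fin d → ℝ => Sum.elim (Pi.single i (1 : ℝ)) x) '' body (S i) ⊆ _
    rw [← hφ, body, AffineMap.image_convexHull, hφ]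
    exact convexHull_mono (Set.subset_iUnion (fun i => (fun x : Fin d → ℝ =>
      Sum.elim (Pi.single i (1 : ℝ)) x) '' Set.range (S i).points) i)
  · exact convexHull_mono (Set.iUnion_mono fun i => Set.image_mono (subset_convexHull ℝ _))

/-- Without interior lattice points in the small multiples, the simplex is a Cayley polytope of
segments: the isomorphism is `exists_paired_coordinates` after barycentric coordinates. -/
theorem exists_unimodularIso {d n : ℕ} (hd : 1 ≤ d) (hn : n + 1 = 2 * d)
    {s : Affine.Simplex ℝ (Fin n → ℝ) n} (hlat : IsLatticeSimplex s) (hs : FacetsBasic s)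
    (h : ∀ k : ℕ, 1 ≤ k → k ≤ d - 1 →
      interior ((k : ℝ) • body s) ∩ latticePoints (Fin n) = ∅) :
    ∃ S : Fin d → Affine.Simplex ℝ (Fin d → ℝ) 1, (∀ i, IsLatticeSimplex (S i)) ∧
      UnimodularIso (body s) (cayley fun i => body (S i)) := by
  obtain ⟨D, hD, hden⟩ := exists_common_denominator hlat
  have hZ := latticePoints_subset_coneLattice hlat
  obtain ⟨e, F, hinj, hF, hp, hq⟩ := exists_paired_coordinates (L := coneLattice s.points)
    (d := d) (by simp [hn]) hd hZ (fun x hx j hj => hs.mem_latticePoints (by omega) hlat hx j hj)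
    hD hden (fun x hx => le_sum_of_no_interior_points h hx)
  have hsingle : ∀ i : Fin (n + 1), (Pi.single i (1 : ℝ) : Fin (n + 1) → ℝ) ∈
      latticePoints (Fin (n + 1)) := fun i => mem_latticePoints_iff.2 fun l => by
    by_cases hl : l = i
    · subst hl; exact ⟨1, by simp⟩
    · exact ⟨0, by simp [hl]⟩
  let w : Fin d → Fin d → ℝ := fun j l => F (Pi.single (e (.inr j)) 1) (.inr l)
  have hFq : ∀ j, F (Pi.single (e (.inr j)) 1) = Sum.elim (Pi.single j 1) (w j) := fun j => by
    ext (l | l)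
    · exact hq j l
    · rfl
  have hw0 : ∀ j, 0 ≠ w j := fun j h0 => by
    have h1 : F (Pi.single (e (.inl j)) 1) = F (Pi.single (e (.inr j)) 1) := by
      rw [hp, hFq, ← h0]
    have h2 := congrFun (hinj h1) (e (.inl j))
    simp at h2
  have hwlat : ∀ j, w j ∈ latticePoints (Fin d) := fun j => by
    have := mem_latticePoints_iff.1 ((hF _).2 (hZ (hsingle (e (.inr j)))))
    exact mem_latticePoints_iff.2 fun l => this (.inr l)
  let S : Fin d → Affine.Simplex ℝ (Fin d → ℝ) 1 := fun j =>
    ⟨![0, w j], affineIndependent_of_ne ℝ (hw0 j)⟩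
  let f : (Fin n → ℝ) →ᵃ[ℝ] (Fin d ⊕ Fin d → ℝ) :=
    F.toAffineMap.comp (vertexBasis s).coords
  have hfv : ∀ i, f (s.points i) = F (Pi.single i 1) := fun i => by
    have : (vertexBasis s).coords (s.points i) = Pi.single i 1 := by
      ext l
      rw [AffineBasis.coords_apply, ← coe_vertexBasis, AffineBasis.coord_apply, Pi.single_apply]
    simp [f, this]
  have hfinj : Function.Injective f := fun y z hyz => by
    have h1 : (vertexBasis s).coords y = (vertexBasis s).coords z := hinj hyz
    exact (vertexBasis s).ext_elem fun i => congrFun h1 i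
  have himage : f '' body s = cayley fun i => body (S i) := by
    rw [cayley_segments, body, AffineMap.image_convexHull]
    congr 1
    rw [← Set.range_comp]
    ext y
    simp only [Set.mem_range, Function.comp_apply, Set.mem_iUnion, Set.mem_image]
    constructor
    · rintro ⟨i, rfl⟩
      obtain ⟨j | j, rfl⟩ := e.surjective i
      · exact ⟨j, 0, ⟨0, rfl⟩, by rw [hfv, hp]⟩
      · exact ⟨j, w j, ⟨1, rfl⟩, by rw [hfv, hFq]⟩
    · rintro ⟨j, x, ⟨i, rfl⟩, rfl⟩
      fin_cases i
      · exact ⟨e (.inl j), by rw [hfv, hp]; rfl⟩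
      · exact ⟨e (.inr j), by rw [hfv, hFq]; rfl⟩
  refine ⟨S, fun j i => ?_, f, ?_, ?_, himage⟩
  · fin_cases i
    · exact latticePoints_zero
    · exact hwlat j
  · rw [← himage, ← AffineSubspace.map_span, AffineSubspace.coe_map]
    exact hfinj.injOn.bijOn_image
  · intro x _
    have hx : f x = F ((vertexBasis s).coords x) := rfl
    rw [hx, hF, mem_coneLattice]
    have h1 : ∑ i, (vertexBasis s).coords x i = 1 := (vertexBasis s).sum_coord_apply_eq_one x
    have h2 : ∑ i, (vertexBasis s).coords x i • s.points i = x :=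
      (vertexBasis s).linear_combination_coord_eq_self x
    rw [h1, h2]
    exact ⟨fun h => h.2, fun h => ⟨⟨1, by simp⟩, h⟩⟩

theorem cayley_coordinate_nonneg {r d : ℕ} (P : Fin r → Set (Fin d → ℝ)) (i : Fin r)
    {y : Fin r ⊕ Fin d → ℝ} (hy : y ∈ cayley P) :
    0 ≤ y (.inl i) := by
  have hsub : cayley P ⊆ {y | 0 ≤ y (.inl i)} := by
    refine convexHull_min (Set.iUnion_subset fun j => ?_) ?_
    · rintro _ ⟨x, _, rfl⟩
      simp only [Set.mem_ofPred_eq, Sum.elim_inl, Pi.single_apply]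
      split_ifs <;> simp
    · exact convex_halfSpace_ge (LinearMap.proj (R := ℝ) (φ := fun _ => ℝ) (Sum.inl i)).isLinear 0
  exact hsub hy

theorem cayley_sum_eq_one {r d : ℕ} (P : Fin r → Set (Fin d → ℝ))
    {y : Fin r ⊕ Fin d → ℝ} (hy : y ∈ cayley P) :
    ∑ i, y (.inl i) = 1 := by
  have hsub : cayley P ⊆ {y | ∑ i, y (.inl i) = 1} := by
    refine convexHull_min (Set.iUnion_subset fun j => ?_) ?_
    · rintro _ ⟨x, _, rfl⟩
      simp
    · have := convex_hyperplane (𝕜 := ℝ) (∑ i : Fin r,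
        LinearMap.proj (R := ℝ) (φ := fun _ : Fin r ⊕ Fin d => ℝ) (Sum.inl i)).isLinear 1
      simpa using this
  exact hsub hy

/-- Small multiples of a simplex isomorphic to a Cayley polytope of `d` factors have no interior lattice
points: the `d` coordinates over the `e_i` would be positive integers with sum `k`. -/
theorem interior_inter_latticePoints_eq_empty {d n : ℕ}
    {s : Affine.Simplex ℝ (Fin n → ℝ) n} {P : Fin d → Set (Fin d → ℝ)} (hP : ∀ i, (P i).Nonempty)
    (hiso : UnimodularIso (body s) (cayley P)) {k : ℕ} (hk : 1 ≤ k) (hkd : k ≤ d - 1) :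
    interior ((k : ℝ) • body s) ∩ latticePoints (Fin n) = ∅ := by
  obtain ⟨f, -, hlat, himage⟩ := hiso
  rw [affineSpan_body] at hlat
  rw [Set.eq_empty_iff_forall_notMem]
  rintro x ⟨hx, hxlat⟩
  have hkR : (k : ℝ) ≠ 0 := by exact_mod_cast (by omega : k ≠ 0)
  rw [interior_smul₀ hkR] at hx
  obtain ⟨y, hy, rfl⟩ := hx
  -- The coordinates over the `e_i` are positive at an interior point.
  have hpos : ∀ i, 0 < f y (.inl i) := by
    intro i
    obtain ⟨u, hu⟩ := hP i
    have hmem : (Sum.elim (Pi.single i (1 : ℝ)) u : Fin d ⊕ Fin d → ℝ) ∈ cayley P :=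
      subset_convexHull ℝ _ (Set.mem_iUnion.2 ⟨i, u, hu, rfl⟩)
    rw [← himage] at hmem
    obtain ⟨p, hp, hfp⟩ := hmem
    have hcont : Continuous fun t : ℝ => AffineMap.lineMap p y t :=
      AffineMap.lineMap_continuous
    have hnhds : ∀ᶠ t in 𝓝[>] (1 : ℝ), AffineMap.lineMap p y t ∈ body s := by
      have : Tendsto (fun t : ℝ => AffineMap.lineMap p y t) (𝓝 1) (𝓝 y) := by
        simpa using hcont.tendsto 1
      exact (this.eventually (mem_interior_iff_mem_nhds.1 hy)).filter_mono nhdsWithin_le_nhds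
    obtain ⟨t, ht, ht1⟩ := (hnhds.and self_mem_nhdsWithin).exists
    -- The segment from `p`, where the coordinate is `1`, can be prolonged beyond `y` inside the body,
    -- where the coordinate is still nonnegative.
    have ht1' : (1 : ℝ) < t := ht1
    have h0 := cayley_coordinate_nonneg P i (himage ▸ Set.mem_image_of_mem f ht)
    rw [AffineMap.apply_lineMap, AffineMap.lineMap_apply, hfp] at h0
    simp only [vsub_eq_sub, vadd_eq_add, Pi.add_apply, Pi.smul_apply, Pi.sub_apply, Sum.elim_inl,
      Pi.single_eq_same, smul_eq_mul] at h0
    nlinarith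
  have hsum : ∑ i, f y (.inl i) = 1 :=
    cayley_sum_eq_one P (himage ▸ Set.mem_image_of_mem f (interior_subset hy))
  -- Homogenising `f` with the lattice point `f 0` makes `k • f y` a lattice point.
  have hf0 : f 0 ∈ latticePoints (Fin d ⊕ Fin d) :=
    (hlat 0 (AffineSubspace.mem_top ..)).2 latticePoints_zero
  have hfx : f ((k : ℝ) • y) ∈ latticePoints (Fin d ⊕ Fin d) :=
    (hlat _ (AffineSubspace.mem_top ..)).2 hxlat
  have hdec : ∀ z, f z = f.linear z + f 0 := fun z => by
    have := f.map_vadd 0 z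
    simpa using this
  have hkf : (k : ℝ) • f y = f ((k : ℝ) • y) + ((k - 1 : ℤ) : ℝ) • f 0 := by
    rw [hdec y, hdec ((k : ℝ) • y), map_smul]
    push_cast
    module
  have hmem : (k : ℝ) • f y ∈ latticePoints (Fin d ⊕ Fin d) := by
    rw [hkf]
    exact latticePoints_add hfx (latticePoints_zsmul hf0 _)
  have hge : ∀ i, (1 : ℝ) ≤ k * f y (.inl i) := by
    intro i
    obtain ⟨m, hm⟩ := mem_latticePoints_iff.1 hmem (.inl i)
    rw [Pi.smul_apply, smul_eq_mul] at hm
    have : (0 : ℝ) < m := by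
      rw [← hm]
      exact mul_pos (by positivity) (hpos i)
    have : 0 < m := by exact_mod_cast this
    rw [hm]
    exact_mod_cast this
  have hfin : (d : ℝ) ≤ k := by
    calc (d : ℝ) = ∑ _i : Fin d, (1 : ℝ) := by simp
      _ ≤ ∑ i : Fin d, k * f y (.inl i) := Finset.sum_le_sum fun i _ => hge i
      _ = k := by rw [← Finset.mul_sum, hsum, mul_one]
  have : d ≤ k := by exact_mod_cast hfin
  omega

end GenWhite

theorem theorem2 (d : ℕ) (hd : 1 ≤ d)
    (Δ : Affine.Simplex ℝ (Fin (2 * d - 1) → ℝ) (2 * d - 1))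
    (hlat : GenWhite.IsLatticeSimplex Δ)
    (hbasic : GenWhite.FacetsBasic Δ) :
    (∀ k : ℕ, 1 ≤ k → k ≤ d - 1 →
        interior ((k : ℝ) • GenWhite.body Δ) ∩
          GenWhite.latticePoints (Fin (2 * d - 1)) = ∅) ↔
      ∃ S : Fin d → Affine.Simplex ℝ (Fin d → ℝ) 1,
        (∀ i, GenWhite.IsLatticeSimplex (S i)) ∧
        GenWhite.UnimodularIso (GenWhite.body Δ)
          (GenWhite.cayley fun i => GenWhite.body (S i)) := by
  constructor
  · exact GenWhite.exists_unimodularIso hd (by omega) hlat hbasic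
  · rintro ⟨S, -, hiso⟩ k hk hkd
    exact GenWhite.interior_inter_latticePoints_eq_empty
      (fun i => (Set.range_nonempty _).convexHull) hiso hk hkd
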